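/- Conventions. Let $A$ be a commutative $\mathbb R$-algebra with $1$. A quadratic module in $A$ is a set $M\subseteq A$ with $M+M\subseteq M$, $1\in M$ and $a^2M\subseteq M$ for all $a\in A$. $\mathrm{QM}(S)$ is the smallest quadratic module containing $S\subseteq A$, and $M$ is finitely generated if $M=\mathrm{QM}(f_1,\dots,f_s)$ for some $f_1,\dots,f_s\in A$. Equip $A$ with the finest locally convex vector space topology; $\overline M$ denotes the closure of $M$, and $M^{\ddagger}$ the sequential closure of $M$, i.e. the set of all limits of sequences from $M$. $M^{\vee\vee}$ is the set of all $x\in A$ with $L(x)\ge 0$ for every linear functional $L:A\to\mathbb R$ that is nonnegative on $M$. $\mathcal S(M)$ is the set of all unital $\mathbb R$-algebra homomorphisms $\alpha:A\to\mathbb R$ with $\alpha(M)\subseteq\mathbb R_{\ge0}$, and $\mathrm{Pos}(\mathcal S(M))=\{a\in A\mid \alpha(a)\ge 0\text{ for all }\alpha\in\mathcal S(M)\}$. The quadratic module $M$ is closed if $M=M^{\vee\vee}$, saturated if $M=\mathrm{Pos}(\mathcal S(M))$, and has the $\ddagger$-property if $M^{\ddagger}=\mathrm{Pos}(\mathcal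 S(M))$. For a subspace $V\subseteq A$, $\sum V^2$ is the set of finite sums of squares of elements of $V$. A stability map for a quadratic module $N$ with respect to generators $a_1,\dots,a_k$ of $N$ is a map $\Phi$ that assigns to each finite dimensional $\mathbb R$-subspace $U$ of $A$ a finite dimensional $\mathbb R$-subspace $\Phi(U)$ of $A$ such that $$N\cap U\subseteq\Big\{\sigma_0+\sigma_1a_1+\dots+\sigma_ka_k\ \Big|\ \sigma_0,\dots,\sigma_k\in\textstyle\sum \Phi(U)^2\Big\}.$$ Theorem. Let $A$ be a commutative $\mathbb R$-algebra with $1$ and $M\subseteq A$ a quadratic module. Let $b_1,\dots,b_t\in A$ and let $\lambda_i\le\Lambda_i$ $(i=1,\dots,t)$ be real numbers such that $\Lambda_i-b_i\in M$ and $b_i-\lambda_i\in M$ for all $i$. Put $\Lambda=\prod_{i=1}^t[\lambda_i,\Lambda_i]$ and, for $r\in\Lambda$ and an $\mathbb R[b_1,\dots,b_t]$-submodule $W$ of $A$, let $J_r(W)=\{\sum_{i=1}^t(b_i-r_i)w_i\mid w_1,\dots,w_t\in W\}$ and $J_r=J_r(A)$. (1) For every finitely generated $\mathbb R[b_1,\dots,b_t]$-submodule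 $W$ of $A$, $$\bigcap_{r\in\Lambda}\big(M+J_r(W)\big)\subseteq M^{\ddagger}.$$ (2) Suppose that $M=\mathrm{QM}(f_1,\dots,f_s)$ is finitely generated, and that there is one map $\Phi$ which, for every $r\in\Lambda$, is a stability map for $M+J_r$ with respect to the generators $f_1,\dots,f_s,\pm(b_1-r_1),\dots,\pm(b_t-r_t)$. If $M+J_r$ is closed for every $r\in\Lambda$, then $M^{\ddagger}=\overline M$. If $M+J_r$ is saturated for every $r\in\Lambda$, then $M$ has the $\ddagger$-property. -/

import Mathlib

open scoped Pointwise

noncomputable section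

namespace FibreTheorem

/-! ### The finest locally convex topology and the closures of a cone -/

section VectorSpace

variable (E : Type*) [AddCommGroup E] [Module ℝ E]

/-- `τ` makes the real vector space `E` a locally convex topological vector space. -/
def IsLocallyConvexTopology (τ : TopologicalSpace E) : Prop :=
  @IsTopologicalAddGroup E τ _ ∧ @ContinuousSMul ℝ E _ _ τ ∧ @LocallyConvexSpace ℝ E _ _ _ _ τ

/-- The finest locally convex vector space topology on `E`. In Mathlib's order on topologies
finer means smaller, so this is an infimum; `isLocallyConvexTopology_finest` shows that it is
itself locally convex. -/
@[reducible]
def finestLocallyConvexTopology : TopologicalSpace E :=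
  sInf {τ | IsLocallyConvexTopology E τ}

theorem isLocallyConvexTopology_finest :
    IsLocallyConvexTopology E (finestLocallyConvexTopology E) :=
  ⟨topologicalAddGroup_sInf fun _ h => h.1, continuousSMul_sInf fun _ h => h.2.1,
    LocallyConvexSpace.sInf fun _ h => h.2.2⟩

theorem finestLocallyConvexTopology_le {τ : TopologicalSpace E}
    (h : IsLocallyConvexTopology E τ) : finestLocallyConvexTopology E ≤ τ :=
  sInf_le h

variable {E}

/-- `M^‡`: the set of all limits of sequences from `M`, in the finest locally convex topology. -/
def ddagger (M : Set E) : Set E :=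
  @seqClosure E (finestLocallyConvexTopology E) M

/-- The closure of `M` in the finest locally convex topology. -/
def lcClosure (M : Set E) : Set E :=
  @closure E (finestLocallyConvexTopology E) M

/-- The double dual cone `M^{∨∨}`. -/
def doubleDual (M : Set E) : Set E :=
  {x | ∀ L : E →ₗ[ℝ] ℝ, (∀ m ∈ M, 0 ≤ L m) → 0 ≤ L x}

/-- `M` is closed if it equals its double dual cone. -/
def IsClosedCone (M : Set E) : Prop :=
  M = doubleDual M

end VectorSpace

/-! ### Quadratic modules -/

section Algebra

variable {A : Type*} [CommRing A] [Algebra ℝ A]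

/-- Quadratic modules: `M + M ⊆ M`, `1 ∈ M` and `A² · M ⊆ M`. -/
structure IsQuadraticModule (M : Set A) : Prop where
  add_mem : ∀ x ∈ M, ∀ y ∈ M, x + y ∈ M
  one_mem : 1 ∈ M
  sq_mul_mem : ∀ a : A, ∀ m ∈ M, a ^ 2 * m ∈ M

/-- `QM(S)`: the smallest quadratic module containing `S`. -/
def QM (S : Set A) : Set A :=
  ⋂₀ {N | IsQuadraticModule N ∧ S ⊆ N}

/-- `S(M)`: the real characters of `A` that are nonnegative on `M`. -/
def positivitySet (M : Set A) : Set (A →ₐ[ℝ] ℝ) :=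
  {α | ∀ a ∈ M, 0 ≤ α a}

/-- `Pos(Y)`: the elements of `A` that are nonnegative on the set `Y` of real characters. -/
def Pos (Y : Set (A →ₐ[ℝ] ℝ)) : Set A :=
  {a | ∀ α ∈ Y, 0 ≤ α a}

/-- `M` is saturated if `M = Pos(S(M))`. -/
def IsSaturated (M : Set A) : Prop :=
  M = Pos (positivitySet M)

/-- `M` has the `‡`-property if `M^‡ = Pos(S(M))`. -/
def HasDDaggerProperty (M : Set A) : Prop :=
  ddagger M = Pos (positivitySet M)

/-! ### Stability -/

/-- `∑ V²`: the (finite) sums of squares of elements of `V`. -/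
def sumsOfSquares (V : Submodule ℝ A) : Set A :=
  (AddSubmonoid.closure {x : A | ∃ v ∈ V, x = v ^ 2} : Set A)

/-- The elements `σ₀ + ∑ i, σ i * a i` with all of `σ₀`, `σ i` in `∑ V²`. -/
def boundedQM {ι : Type*} [Fintype ι] (a : ι → A) (V : Submodule ℝ A) : Set A :=
  {x | ∃ σ₀ ∈ sumsOfSquares V, ∃ σ : ι → A,
    (∀ i, σ i ∈ sumsOfSquares V) ∧ x = σ₀ + ∑ i, σ i * a i}

/-- `Φ` is a stability map for the quadratic module `M`, with respect to the generators `a i`: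
it assigns to every finite dimensional subspace `U` of `A` a finite dimensional subspace `Φ U`
such that the elements of `M ∩ U` have a representation in terms of the generators with
sums of squares of elements of `Φ U`. The values of `Φ` at other subspaces play no role. -/
def IsStabilityMap {ι : Type*} [Fintype ι] (M : Set A) (a : ι → A)
    (Φ : Submodule ℝ A → Submodule ℝ A) : Prop :=
  ∀ U : Submodule ℝ A, FiniteDimensional ℝ U →
    FiniteDimensional ℝ (Φ U) ∧ M ∩ (U : Set A) ⊆ boundedQM a (Φ U)

/-! ### Fibre modules -/

variable {t : ℕ}

/-- `J_r(W) = {∑ i, (b i - r i) w i | w i ∈ W}`. -/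
def fibreJ (b : Fin t → A) (r : Fin t → ℝ) (W : Set A) : Set A :=
  {x | ∃ w : Fin t → A, (∀ i, w i ∈ W) ∧ x = ∑ i, (b i - algebraMap ℝ A (r i)) * w i}

/-- The fibre module `M + J_r`, where `J_r = J_r(A)` is the ideal generated by the
elements `b i - r i`. -/
def fibreModule (M : Set A) (b : Fin t → A) (r : Fin t → ℝ) : Set A :=
  M + fibreJ b r Set.univ

/-- The canonical generators `f₁, …, f_s, ±(b₁ - r₁), …, ±(b_t - r_t)` of the fibre module
`M + J_r`, where `M` is generated by `f₁, …, f_s`. -/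
def fibreGenerators {s : ℕ} (f : Fin s → A) (b : Fin t → A) (r : Fin t → ℝ) :
    Fin s ⊕ (Fin t ⊕ Fin t) → A :=
  Sum.elim f (Sum.elim (fun i => b i - algebraMap ℝ A (r i))
    (fun i => -(b i - algebraMap ℝ A (r i))))

end Algebra

end FibreTheorem

end

/-!
Let `q` be a sum of squares dominating generators of `W`. If `x` lies in `M + J_r(W)`, the
coefficients of its `J_r(W)`-part are bounded with respect to `M`, so Young's inequality gives for
every `ε > 0` a constant `D` with `x + q (ε + D |b - r|²) ∈ M`. By compactness of the box, `D` can
be chosen independently of `r`. An approximate partition of unity by squares `h_k²` concentrated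
near points `y_k` of the box, `∑ h_k² |b - y_k|² ≈ 0`, then removes the distance term: summing
`h_k² (x + q (ε + D |b - y_k|²))` gives `x + ε (q + x² + 1) ∈ M` for all `ε > 0`. Such partitions of
unity come from Bernstein polynomials. Uniform stability supplies one module `W` that works in all
fibres at once.
-/

namespace FibreTheorem

variable {A : Type*} [CommRing A] {M : Set A}

theorem subset_QM (S : Set A) : S ⊆ QM S :=
  Set.subset_sInter fun _ h => h.2

theorem isSumSq_sum_sq_add_one {ι : Type*} [Fintype ι] (w : ι → A) :
    IsSumSq (∑ i, (w i ^ 2 + 1)) :=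
  .sum fun i _ => by simpa [pow_two] using (IsSumSq.mul_self (w i)).add (.mul_self 1)

namespace IsQuadraticModule

theorem sq_mem (hM : IsQuadraticModule M) (a : A) : a ^ 2 ∈ M := by
  simpa using hM.sq_mul_mem a 1 hM.one_mem

theorem zero_mem (hM : IsQuadraticModule M) : (0 : A) ∈ M := by
  simpa using hM.sq_mem 0

theorem sum_mem (hM : IsQuadraticModule M) {ι : Type*} {s : Finset ι} {f : ι → A}
    (h : ∀ i ∈ s, f i ∈ M) : ∑ i ∈ s, f i ∈ M :=
  Finset.sum_induction f (· ∈ M) (fun a b ha hb => hM.add_mem a ha b hb) hM.zero_mem h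

theorem isSumSq_mul_mem (hM : IsQuadraticModule M) {q m : A} (hq : IsSumSq q) (hm : m ∈ M) :
    q * m ∈ M := by
  induction hq with
  | zero => simpa using hM.zero_mem
  | sq_add a _ ih =>
    rw [add_mul, ← pow_two]
    exact hM.add_mem _ (hM.sq_mul_mem a m hm) _ ih

theorem add_isSumSq_mul_mono (hM : IsQuadraticModule M) {x q d e : A} (hq : IsSumSq q)
    (h : x + q * d ∈ M) (hde : e - d ∈ M) : x + q * e ∈ M := by
  convert hM.add_mem _ h _ (hM.isSumSq_mul_mem hq hde) using 1
  ring

variable [Algebra ℝ A]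

theorem smul_mem (hM : IsQuadraticModule M) {c : ℝ} (hc : 0 ≤ c) {m : A} (hm : m ∈ M) :
    c • m ∈ M := by
  have h := hM.sq_mul_mem (algebraMap ℝ A (√c)) m hm
  rwa [← map_pow, Real.sq_sqrt hc, ← Algebra.smul_def] at h

theorem algebraMap_mem (hM : IsQuadraticModule M) {c : ℝ} (hc : 0 ≤ c) :
    algebraMap ℝ A c ∈ M := by
  rw [Algebra.algebraMap_eq_smul_one]
  exact hM.smul_mem hc hM.one_mem

end IsQuadraticModule

/-- The relation `|f| ≤ d` with respect to the preorder `x ≤ y ↔ y - x ∈ M` on `A`. The bound `d`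
is an element of `A`; a bound by a real number `c` is expressed with `d = algebraMap ℝ A c`. -/
def AbsLE (M : Set A) (f d : A) : Prop :=
  d - f ∈ M ∧ d + f ∈ M

namespace AbsLE

theorem of_mem (hM : IsQuadraticModule M) {m : A} (hm : m ∈ M) : AbsLE M m m :=
  ⟨by simpa using hM.zero_mem, hM.add_mem _ hm _ hm⟩

theorem neg {f d : A} (h : AbsLE M f d) : AbsLE M (-f) d :=
  ⟨by simpa using h.2, by simpa [sub_eq_add_neg] using h.1⟩

theorem add (hM : IsQuadraticModule M) {f g d e : A} (hf : AbsLE M f d) (hg : AbsLE M g e) :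
    AbsLE M (f + g) (d + e) := by
  constructor
  · convert hM.add_mem _ hf.1 _ hg.1 using 1
    ring
  · convert hM.add_mem _ hf.2 _ hg.2 using 1
    ring

theorem sum (hM : IsQuadraticModule M) {ι : Type*} {s : Finset ι} {f d : ι → A}
    (h : ∀ i ∈ s, AbsLE M (f i) (d i)) : AbsLE M (∑ i ∈ s, f i) (∑ i ∈ s, d i) := by
  constructor
  · rw [← Finset.sum_sub_distrib]
    exact hM.sum_mem fun i hi => (h i hi).1
  · rw [← Finset.sum_add_distrib]
    exact hM.sum_mem fun i hi => (h i hi).2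

theorem mono (hM : IsQuadraticModule M) {f d e : A} (h : AbsLE M f d) (hde : e - d ∈ M) :
    AbsLE M f e := by
  constructor
  · simpa using hM.add_mem _ hde _ h.1
  · simpa [← add_assoc] using hM.add_mem _ hde _ h.2

variable [Algebra ℝ A]

theorem smul (hM : IsQuadraticModule M) {c : ℝ} (hc : 0 ≤ c) {f d : A} (h : AbsLE M f d) :
    AbsLE M (c • f) (c • d) := by
  constructor
  · simpa only [smul_sub] using hM.smul_mem hc h.1
  · simpa only [smul_add] using hM.smul_mem hc h.2

/- Polarization: `4 w f = (w + 1)² f - (w - 1)² f`, and `|f| ≤ d` bounds both terms. -/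
theorem mul_left (hM : IsQuadraticModule M) {f d : A} (h : AbsLE M f d) (w : A) :
    AbsLE M (w * f) ((1 / 2 : ℝ) • ((w ^ 2 + 1) * d)) := by
  constructor
  · convert hM.smul_mem (c := 1 / 4) (by norm_num) (hM.add_mem _ (hM.sq_mul_mem (w + 1) _ h.1) _
      (hM.sq_mul_mem (w - 1) _ h.2)) using 1
    algebra
  · convert hM.smul_mem (c := 1 / 4) (by norm_num) (hM.add_mem _ (hM.sq_mul_mem (w + 1) _ h.2) _
      (hM.sq_mul_mem (w - 1) _ h.1)) using 1
    algebra

theorem mul_left_weighted (hM : IsQuadraticModule M) {f d : A} (h : AbsLE M f d) (z : A) {δ : ℝ}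
    (hδ : 0 < δ) : AbsLE M (z * f) ((1 / 2 : ℝ) • ((algebraMap ℝ A δ + δ⁻¹ • z ^ 2) * d)) := by
  convert (h.mul_left hM (δ⁻¹ • z)).smul hM hδ.le using 1
  · rw [smul_mul_assoc, smul_inv_smul₀ hδ.ne']
  · rw [smul_comm δ, ← smul_mul_assoc δ, smul_add, smul_pow, smul_smul δ, pow_two δ⁻¹,
      mul_inv_cancel_left₀ hδ.ne', add_comm (algebraMap ℝ A δ), Algebra.algebraMap_eq_smul_one]

theorem mono_algebraMap (hM : IsQuadraticModule M) {c d : ℝ} (hcd : c ≤ d) {f : A}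
    (h : AbsLE M f (algebraMap ℝ A c)) : AbsLE M f (algebraMap ℝ A d) := by
  refine h.mono hM ?_
  rw [← map_sub]
  exact hM.algebraMap_mem (sub_nonneg.2 hcd)

theorem algebraMap_abs (hM : IsQuadraticModule M) (c : ℝ) :
    AbsLE M (algebraMap ℝ A c) (algebraMap ℝ A |c|) := by
  constructor
  · rw [← map_sub]
    exact hM.algebraMap_mem (sub_nonneg.2 (le_abs_self c))
  · rw [← map_add]
    exact hM.algebraMap_mem (by linarith [neg_abs_le c])

theorem sq_sub_sq_mem (hM : IsQuadraticModule M) {c : ℝ} (hc : 0 < c) {f : A}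
    (h : AbsLE M f (algebraMap ℝ A c)) : algebraMap ℝ A (c ^ 2) - f ^ 2 ∈ M := by
  have hsum := hM.smul_mem (c := (2 * c)⁻¹) (by positivity)
    (hM.add_mem _ (hM.sq_mul_mem (algebraMap ℝ A c - f) _ h.2) _
      (hM.sq_mul_mem (algebraMap ℝ A c + f) _ h.1))
  have key : (algebraMap ℝ A c - f) ^ 2 * (algebraMap ℝ A c + f) +
      (algebraMap ℝ A c + f) ^ 2 * (algebraMap ℝ A c - f) =
      (2 * c) • (algebraMap ℝ A (c ^ 2) - f ^ 2) := by algebra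
  rwa [key, inv_smul_smul₀ (by positivity)] at hsum

theorem mul (hM : IsQuadraticModule M) {c d : ℝ} (hc : 0 ≤ c) (hd : 0 ≤ d) {f g : A}
    (hf : AbsLE M f (algebraMap ℝ A c)) (hg : AbsLE M g (algebraMap ℝ A d)) :
    AbsLE M (f * g) (algebraMap ℝ A (c * d)) := by
  rcases hd.eq_or_lt with rfl | hd
  · simpa using hg.mul_left hM f
  have hgf : AbsLE M (g * f)
      ((1 / 2 : ℝ) • ((algebraMap ℝ A d + d⁻¹ • g ^ 2) * algebraMap ℝ A c)) :=
    hf.mul_left_weighted hM g hd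
  have hg2 : (c / 2 * d⁻¹) • (algebraMap ℝ A (d ^ 2) - g ^ 2) ∈ M :=
    hM.smul_mem (by positivity) (hg.sq_sub_sq_mem hM hd)
  rw [mul_comm f g]
  refine hgf.mono hM ?_
  convert hg2 using 1
  have hdd : c * d = c / 2 * d + c / 2 * d⁻¹ * d ^ 2 := by field_simp; ring
  rw [hdd]
  algebra

theorem pow (hM : IsQuadraticModule M) {c : ℝ} (hc : 0 ≤ c) {f : A}
    (hf : AbsLE M f (algebraMap ℝ A c)) (n : ℕ) : AbsLE M (f ^ n) (algebraMap ℝ A (c ^ n)) := by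
  induction n with
  | zero => simpa using of_mem hM hM.one_mem
  | succ n ih =>
    rw [pow_succ, pow_succ]
    exact ih.mul hM (pow_nonneg hc n) hc hf

theorem of_sub_mem (hM : IsQuadraticModule M) {f : A} {lo hi : ℝ}
    (hhi : algebraMap ℝ A hi - f ∈ M) (hlo : f - algebraMap ℝ A lo ∈ M) :
    AbsLE M f (algebraMap ℝ A (|lo| + |hi|)) := by
  constructor
  · convert hM.add_mem _ hhi _ (hM.algebraMap_mem (c := |lo| + |hi| - hi)
      (by linarith [le_abs_self hi, abs_nonneg lo])) using 1
    algebra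
  · convert hM.add_mem _ hlo _ (hM.algebraMap_mem (c := |lo| + |hi| + lo)
      (by linarith [neg_abs_le lo, abs_nonneg hi])) using 1
    algebra

end AbsLE

variable [Algebra ℝ A]

/-- The subalgebra of the elements of `A` that are bounded by a real number with respect to the
preorder defined by `M`. -/
def IsQuadraticModule.boundedSubalgebra (hM : IsQuadraticModule M) : Subalgebra ℝ A where
  carrier := {a | ∃ c : ℝ, 0 ≤ c ∧ AbsLE M a (algebraMap ℝ A c)}
  mul_mem' := fun ⟨c, hc, ha⟩ ⟨d, hd, hb⟩ => ⟨c * d, mul_nonneg hc hd, ha.mul hM hc hd hb⟩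
  add_mem' := fun ⟨c, hc, ha⟩ ⟨d, hd, hb⟩ =>
    ⟨c + d, add_nonneg hc hd, by simpa only [map_add] using ha.add hM hb⟩
  algebraMap_mem' := fun c => ⟨|c|, abs_nonneg c, AbsLE.algebraMap_abs hM c⟩

theorem IsQuadraticModule.adjoin_range_le_boundedSubalgebra (hM : IsQuadraticModule M)
    {ι : Type*} {b : ι → A} {lo hi : ι → ℝ} (hhi : ∀ i, algebraMap ℝ A (hi i) - b i ∈ M)
    (hlo : ∀ i, b i - algebraMap ℝ A (lo i) ∈ M) :
    Algebra.adjoin ℝ (Set.range b) ≤ hM.boundedSubalgebra := by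
  refine Algebra.adjoin_le ?_
  rintro _ ⟨i, rfl⟩
  exact ⟨|lo i| + |hi i|, by positivity, AbsLE.of_sub_mem hM (hhi i) (hlo i)⟩

theorem IsQuadraticModule.exists_forall_absLE (hM : IsQuadraticModule M) {ι : Type*} [Finite ι]
    {a : ι → A} (ha : ∀ i, a i ∈ hM.boundedSubalgebra) :
    ∃ c : ℝ, 0 ≤ c ∧ ∀ i, AbsLE M (a i) (algebraMap ℝ A c) := by
  have := Fintype.ofFinite ι
  choose c hc hac using ha
  exact ⟨∑ i, c i, Finset.sum_nonneg fun i _ => hc i, fun i => (hac i).mono_algebraMap hM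
    (Finset.single_le_sum (fun j _ => hc j) (Finset.mem_univ i))⟩

/-- The square root of twice the Bernstein polynomial of degree `2 * n` and index `2 * j`,
evaluated at `x`. The Bernstein polynomials of even index alone are squares up to positive factors,
and they still add up to almost `1 / 2`. -/
noncomputable def evenBernsteinRoot (n : ℕ) (x : A) (j : ℕ) : A :=
  algebraMap ℝ A √(2 * (2 * n).choose (2 * j)) * x ^ j * (1 - x) ^ (n - j)

theorem evenBernsteinRoot_sq (n : ℕ) (x : A) (j : ℕ) :
    evenBernsteinRoot n x j ^ 2 =
      2 * Polynomial.aeval x (bernsteinPolynomial ℝ (2 * n) (2 * j)) := by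
  have hsub : 2 * n - 2 * j = (n - j) * 2 := by omega
  rw [evenBernsteinRoot, mul_pow, mul_pow, ← map_pow, Real.sq_sqrt (by positivity), ← pow_mul,
    ← pow_mul, bernsteinPolynomial, hsub, mul_comm 2 j]
  simp only [map_mul, map_pow, map_sub, map_one, map_ofNat, map_natCast, Polynomial.aeval_X]
  ring

theorem sum_range_two_mul_add_one {G : Type*} [AddCommMonoid G] (f : ℕ → G) (n : ℕ) :
    ∑ k ∈ Finset.range (2 * n + 1), f k =
      ∑ j ∈ Finset.range (n + 1), f (2 * j) + ∑ j ∈ Finset.range n, f (2 * j + 1) := by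
  induction n with
  | zero => simp
  | succ n ih =>
    rw [mul_add_one, Finset.sum_range_succ _ (2 * n + 2), Finset.sum_range_succ _ (2 * n + 1), ih,
      Finset.sum_range_succ _ (n + 1), Finset.sum_range_succ _ n,
      Finset.sum_range_succ (fun j => f (2 * j + 1)) n, mul_add_one]
    abel

theorem sum_evenBernsteinRoot_sq (n : ℕ) (x : A) :
    ∑ j ∈ Finset.range (n + 1), evenBernsteinRoot n x j ^ 2 = 1 + (1 - 2 * x) ^ (2 * n) := by
  have hsum := congr_arg (Polynomial.aeval x) (bernsteinPolynomial.sum ℝ (2 * n))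
  have halt : ∑ k ∈ Finset.range (2 * n + 1),
      (-1) ^ k * Polynomial.aeval x (bernsteinPolynomial ℝ (2 * n) k) = (1 - 2 * x) ^ (2 * n) := by
    rw [show 1 - 2 * x = -x + (1 - x) by ring, add_pow]
    refine Finset.sum_congr rfl fun k _ => ?_
    simp only [bernsteinPolynomial, map_mul, map_pow, map_sub, map_one, map_natCast,
      Polynomial.aeval_X]
    rw [neg_pow x]
    ring
  rw [map_sum, map_one, sum_range_two_mul_add_one] at hsum
  simp only [sum_range_two_mul_add_one, (even_two_mul _).neg_one_pow,
    (odd_two_mul_add_one _).neg_one_pow, one_mul, neg_mul, Finset.sum_neg_distrib] at halt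
  simp only [evenBernsteinRoot_sq, ← Finset.mul_sum]
  linear_combination hsum + halt

theorem evenBernsteinRoot_variance_mem (hM : IsQuadraticModule M) (n : ℕ) {x : A}
    (hx : x * (1 - x) ∈ M) :
    (4 * n : ℝ) • (x * (1 - x)) -
      ∑ j ∈ Finset.range (n + 1), evenBernsteinRoot n x j ^ 2 * (2 * n * x - 2 * j) ^ 2 ∈ M := by
  have hvar := congr_arg (Polynomial.aeval x) (bernsteinPolynomial.variance ℝ (2 * n))
  simp only [sum_range_two_mul_add_one, map_sum, map_add, map_mul, map_pow, map_sub, map_natCast,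
    Polynomial.aeval_X, map_one, nsmul_eq_mul, Nat.cast_mul, Nat.cast_ofNat,
    map_ofNat] at hvar
  -- A Bernstein polynomial of odd index is a square times `x * (1 - x)`.
  have hodd : ∑ j ∈ Finset.range n, (2 * n * x - (2 * j + 1 : ℕ)) ^ 2 *
      Polynomial.aeval x (bernsteinPolynomial ℝ (2 * n) (2 * j + 1)) ∈ M := by
    refine hM.sum_mem fun j hj => ?_
    have hsub : 2 * n - (2 * j + 1) = (n - 1 - j) * 2 + 1 := by
      have := Finset.mem_range.1 hj
      omega
    convert hM.smul_mem (c := (2 * n).choose (2 * j + 1)) (by positivity)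
      (hM.sq_mul_mem (x ^ j * (1 - x) ^ (n - 1 - j) * (2 * n * x - (2 * j + 1 : ℕ))) _ hx) using 1
    rw [bernsteinPolynomial, hsub]
    simp only [map_mul, map_pow, map_sub, map_one, map_natCast, Polynomial.aeval_X,
      Algebra.smul_def (_ : ℝ) (_ : A)]
    ring
  convert hM.smul_mem zero_le_two hodd using 1
  simp only [evenBernsteinRoot_sq, Algebra.smul_def (_ : ℝ) (_ : A), map_mul,
    map_ofNat, map_natCast]
  have heven : ∑ j ∈ Finset.range (n + 1),
      2 * Polynomial.aeval x (bernsteinPolynomial ℝ (2 * n) (2 * j)) * (2 * n * x - 2 * j) ^ 2 =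
      2 * ∑ j ∈ Finset.range (n + 1), (2 * n * x - 2 * j) ^ 2 *
        Polynomial.aeval x (bernsteinPolynomial ℝ (2 * n) (2 * j)) := by
    rw [Finset.mul_sum]
    exact Finset.sum_congr rfl fun j _ => by ring
  rw [heven]
  push_cast at hvar ⊢
  linear_combination -2 * hvar

theorem evenBernsteinRoot_variance_mem_of_one_sub_sq_mem (hM : IsQuadraticModule M) {n : ℕ}
    (hn : 0 < n) {u : A} (hu : 1 - u ^ 2 ∈ M) :
    (1 / n : ℝ) • (1 - u ^ 2) - ∑ j ∈ Finset.range (n + 1),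
      evenBernsteinRoot n ((1 / 2 : ℝ) • (1 + u)) j ^ 2 *
        (u - algebraMap ℝ A (2 * j / n - 1)) ^ 2 ∈ M := by
  set x : A := (1 / 2 : ℝ) • (1 + u) with hx
  have hxu : x * (1 - x) = (1 / 4 : ℝ) • (1 - u ^ 2) := by rw [hx]; algebra
  have hxM : x * (1 - x) ∈ M := by
    rw [hxu]
    exact hM.smul_mem (by norm_num) hu
  have hnode (j : ℕ) : 2 * n * x - 2 * j = (n : ℝ) • (u - algebraMap ℝ A (2 * j / n - 1)) := by
    have hj : (j : A) = algebraMap ℝ A (n / 2 * (2 * j / n)) := by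
      rw [← map_natCast (algebraMap ℝ A)]
      congr 1
      field_simp
    rw [hj, hx, ← map_natCast (algebraMap ℝ A) n]
    algebra
  convert hM.smul_mem (c := ((n : ℝ) ^ 2)⁻¹) (by positivity)
    (evenBernsteinRoot_variance_mem hM n hxM) using 1
  rw [hxu, smul_sub ((n : ℝ) ^ 2)⁻¹, smul_smul, smul_smul, Finset.smul_sum]
  congr 1
  · congr 1
    field_simp
  · refine Finset.sum_congr rfl fun j _ => ?_
    rw [hnode, smul_pow, mul_smul_comm, inv_smul_smul₀ (by positivity)]

/-- The squares `h k ^ 2` form a partition of unity up to an error `η` with respect to the preorder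
defined by `M`, and it is concentrated where the functions `d k` are small: up to `η`, the sum of
the `h k ^ 2 * d k` vanishes. In the applications `d k` is the squared distance to a point. -/
structure IsSqPartition {K : Type*} [Fintype K] (M : Set A) (η : ℝ) (h d : K → A) : Prop where
  absLE_sum_sub_one : AbsLE M (∑ k, h k ^ 2 - 1) (algebraMap ℝ A η)
  sub_sum_mem : algebraMap ℝ A η - ∑ k, h k ^ 2 * d k ∈ M

namespace IsSqPartition

variable {K L : Type*} [Fintype K] [Fintype L]

theorem mono (hM : IsQuadraticModule M) {η θ c : ℝ} {h d e : K → A} (hd : IsSqPartition M η h d)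
    (hc : 0 ≤ c) (hηθ : η ≤ θ) (hcη : c * η ≤ θ) (hde : ∀ k, c • d k - e k ∈ M) :
    IsSqPartition M θ h e where
  absLE_sum_sub_one := hd.absLE_sum_sub_one.mono_algebraMap hM hηθ
  sub_sum_mem := by
    have hsum : ∑ k, h k ^ 2 * (c • d k - e k) ∈ M :=
      hM.sum_mem fun k _ => hM.sq_mul_mem _ _ (hde k)
    convert hM.add_mem _ (hM.add_mem _ (hM.algebraMap_mem (sub_nonneg.2 hcη)) _
      (hM.smul_mem hc hd.sub_sum_mem)) _ hsum using 1
    simp only [mul_sub, Finset.sum_sub_distrib, mul_smul_comm, ← Finset.smul_sum]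
    algebra

theorem absLE_sum_mul (hM : IsQuadraticModule M) {η : ℝ} {h d : K → A}
    (hd : IsSqPartition M η h d) (hη : 0 ≤ η) (hdM : ∀ k, d k ∈ M) :
    AbsLE M (∑ k, h k ^ 2 * d k) (algebraMap ℝ A η) :=
  ⟨hd.sub_sum_mem, hM.add_mem _ (hM.algebraMap_mem hη) _
    (hM.sum_mem fun k _ => hM.sq_mul_mem _ _ (hdM k))⟩

theorem absLE_sum (hM : IsQuadraticModule M) {η : ℝ} {h d : K → A} (hd : IsSqPartition M η h d)
    (hη : η ≤ 1) : AbsLE M (∑ k, h k ^ 2) (algebraMap ℝ A 2) := by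
  have hsum := hd.absLE_sum_sub_one.add hM (AbsLE.of_mem hM hM.one_mem)
  rw [sub_add_cancel, ← map_one (algebraMap ℝ A), ← map_add] at hsum
  exact hsum.mono_algebraMap hM (by linarith)

theorem prod (hM : IsQuadraticModule M) {η : ℝ} (hη₀ : 0 ≤ η) (hη₁ : η ≤ 1) {h d : K → A}
    {g e : L → A} (hd : IsSqPartition M η h d) (he : IsSqPartition M η g e) (hdM : ∀ k, d k ∈ M)
    (heM : ∀ l, e l ∈ M) :
    IsSqPartition M (4 * η) (fun p : K × L => h p.1 * g p.2) fun p => d p.1 + e p.2 where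
  absLE_sum_sub_one := by
    have hprod : ∑ p : K × L, (h p.1 * g p.2) ^ 2 = (∑ k, h k ^ 2) * ∑ l, g l ^ 2 := by
      simp only [mul_pow, Fintype.sum_prod_type, Finset.sum_mul_sum]
    have hbound := (hd.absLE_sum_sub_one.add hM he.absLE_sum_sub_one).add hM
      (hd.absLE_sum_sub_one.mul hM hη₀ hη₀ he.absLE_sum_sub_one)
    rw [← map_add, ← map_add] at hbound
    convert hbound.mono_algebraMap hM (d := 4 * η) (by nlinarith) using 1
    rw [hprod]
    ring
  sub_sum_mem := by
    have hprod : ∑ p : K × L, (h p.1 * g p.2) ^ 2 * (d p.1 + e p.2) =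
        (∑ k, h k ^ 2 * d k) * ∑ l, g l ^ 2 + (∑ k, h k ^ 2) * ∑ l, g l ^ 2 * e l := by
      simp only [Finset.sum_mul_sum, Fintype.sum_prod_type, ← Finset.sum_add_distrib]
      exact Finset.sum_congr rfl fun k _ => Finset.sum_congr rfl fun l _ => by ring
    have hbound := ((hd.absLE_sum_mul hM hη₀ hdM).mul hM hη₀ zero_le_two
      (he.absLE_sum hM hη₁)).add hM ((hd.absLE_sum hM hη₁).mul hM zero_le_two hη₀
        (he.absLE_sum_mul hM hη₀ heM))
    rw [← map_add, ← hprod] at hbound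
    convert hbound.1 using 3
    ring

end IsSqPartition

theorem exists_isSqPartition_of_absLE_half (hM : IsQuadraticModule M) {u : A}
    (hu : AbsLE M u (algebraMap ℝ A (1 / 2))) {η : ℝ} (hη : 0 < η) :
    ∃ (n : ℕ) (h : Fin n → A) (y : Fin n → ℝ),
      IsSqPartition M η h fun k => (u - algebraMap ℝ A (y k)) ^ 2 := by
  obtain ⟨n, hpow, hinv, hn⟩ : ∃ n : ℕ, (1 / 2 : ℝ) ^ n ≤ η ∧ 1 / (n : ℝ) ≤ η ∧ 0 < n := by
    have hpow := (tendsto_pow_atTop_nhds_zero_of_lt_one (r := (1 / 2 : ℝ)) (by norm_num)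
      (by norm_num)).eventually_le_const hη
    have hinv := (tendsto_const_div_atTop_nhds_zero_nat (1 : ℝ)).eventually_le_const hη
    exact (hpow.and (hinv.and (Filter.eventually_gt_atTop 0))).exists
  refine ⟨n + 1, fun j => evenBernsteinRoot n ((1 / 2 : ℝ) • (1 + u)) j,
    fun j => 2 * j / n - 1, ?_, ?_⟩
  · rw [← Finset.sum_range fun j => evenBernsteinRoot n ((1 / 2 : ℝ) • (1 + u)) j ^ 2,
      sum_evenBernsteinRoot_sq, add_sub_cancel_left,
      show 1 - 2 * ((1 / 2 : ℝ) • (1 + u)) = -u by algebra]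
    refine (hu.neg.pow hM (by norm_num) (2 * n)).mono_algebraMap hM (le_trans ?_ hpow)
    exact pow_le_pow_of_le_one (by norm_num) (by norm_num) (by omega)
  · rw [← Finset.sum_range fun j : ℕ => evenBernsteinRoot n ((1 / 2 : ℝ) • (1 + u)) j ^ 2 *
      (u - algebraMap ℝ A (2 * j / n - 1)) ^ 2]
    have hu₁ : 1 - u ^ 2 ∈ M := by
      simpa using (hu.mono_algebraMap hM (d := 1) (by norm_num)).sq_sub_sq_mem hM one_pos
    convert hM.add_mem _ (evenBernsteinRoot_variance_mem_of_one_sub_sq_mem hM hn hu₁) _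
      (hM.add_mem _ (hM.algebraMap_mem (sub_nonneg.2 hinv)) _
        (hM.smul_mem (c := 1 / n) (by positivity) (hM.sq_mem u))) using 1
    algebra

theorem sq_sub_sub_sq_sub_projIcc_mem (hM : IsQuadraticModule M) {b : A} {lo hi : ℝ}
    (hle : lo ≤ hi) (hhi : algebraMap ℝ A hi - b ∈ M) (hlo : b - algebraMap ℝ A lo ∈ M) (z : ℝ) :
    (b - algebraMap ℝ A z) ^ 2 - (b - algebraMap ℝ A (Set.projIcc lo hi hle z)) ^ 2 ∈ M := by
  rcases lt_or_ge z lo with hz | hz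
  · rw [Set.projIcc_of_le_left hle hz.le]
    convert hM.smul_mem (sub_nonneg.2 hz.le) (hM.add_mem _ (hM.smul_mem zero_le_two hlo) _
      (hM.algebraMap_mem (sub_nonneg.2 hz.le))) using 1
    algebra
  rcases le_or_gt z hi with hz' | hz'
  · rw [Set.projIcc_of_mem hle ⟨hz, hz'⟩, sub_self]
    exact hM.zero_mem
  · rw [Set.projIcc_of_right_le hle hz'.le]
    convert hM.smul_mem (sub_nonneg.2 hz'.le) (hM.add_mem _ (hM.smul_mem zero_le_two hhi) _
      (hM.algebraMap_mem (sub_nonneg.2 hz'.le))) using 1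
    algebra

theorem exists_isSqPartition_Icc (hM : IsQuadraticModule M) {b : A} {lo hi : ℝ}
    (hle : lo ≤ hi) (hhi : algebraMap ℝ A hi - b ∈ M) (hlo : b - algebraMap ℝ A lo ∈ M)
    {η : ℝ} (hη : 0 < η) :
    ∃ (n : ℕ) (h : Fin n → A) (y : Fin n → ℝ), (∀ k, y k ∈ Set.Icc lo hi) ∧
      IsSqPartition M η h fun k => (b - algebraMap ℝ A (y k)) ^ 2 := by
  obtain ⟨c, hc, hbc⟩ : ∃ c : ℝ, 0 < c ∧ AbsLE M (c⁻¹ • b) (algebraMap ℝ A (1 / 2)) := by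
    refine ⟨2 * (|lo| + |hi| + 1), by positivity, ?_⟩
    have hb := ((AbsLE.of_sub_mem hM hhi hlo).mono_algebraMap hM (lt_add_one _).le).smul hM
      (c := (2 * (|lo| + |hi| + 1))⁻¹) (by positivity)
    convert hb using 1
    rw [Algebra.smul_def, ← map_mul]
    congr 1
    field_simp
  obtain ⟨n, h, y, hy⟩ := exists_isSqPartition_of_absLE_half hM hbc (η := η / (c ^ 2 + 1))
    (by positivity)
  refine ⟨n, h, fun k => Set.projIcc lo hi hle (c * y k), fun k => (Set.projIcc lo hi hle _).2,
    hy.mono hM (c := c ^ 2) (by positivity) (div_le_self hη.le (by nlinarith)) ?_ fun k => ?_⟩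
  · rw [mul_div_assoc', div_le_iff₀ (by positivity)]
    nlinarith
  · have hscale : c • (c⁻¹ • b - algebraMap ℝ A (y k)) = b - algebraMap ℝ A (c * y k) := by
      rw [smul_sub, smul_inv_smul₀ hc.ne', map_mul, Algebra.smul_def]
    rw [← smul_pow, hscale]
    exact sq_sub_sub_sq_sub_projIcc_mem hM hle hhi hlo _

theorem exists_isSqPartition_pi (hM : IsQuadraticModule M) {ι : Type*} {b : ι → A} {lo hi : ι → ℝ}
    (hle : lo ≤ hi) (hhi : ∀ i, algebraMap ℝ A (hi i) - b i ∈ M)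
    (hlo : ∀ i, b i - algebraMap ℝ A (lo i) ∈ M) (s : Finset ι) {η : ℝ} (hη : 0 < η) :
    ∃ (K : Type) (_ : Fintype K) (h : K → A) (y : K → ι → ℝ), (∀ k, y k ∈ Set.Icc lo hi) ∧
      IsSqPartition M η h fun k => ∑ i ∈ s, (b i - algebraMap ℝ A (y k i)) ^ 2 := by
  classical
  induction s using Finset.induction_on generalizing η with
  | empty =>
    exact ⟨Unit, inferInstance, fun _ => 1, fun _ => lo, fun _ => ⟨le_rfl, hle⟩,
      by simpa [AbsLE] using hM.algebraMap_mem hη.le, by simpa using hM.algebraMap_mem hη.le⟩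
  | insert a s ha ih =>
    have hθ : 0 < min (η / 4) 1 := lt_min (by positivity) one_pos
    obtain ⟨K, _, h, y, hy, hh⟩ := ih hθ
    obtain ⟨n, g, z, hz, hg⟩ := exists_isSqPartition_Icc hM (hle a) (hhi a) (hlo a) hθ
    have hprod := hg.prod hM hθ.le (min_le_right _ _) hh (fun _ => hM.sq_mem _)
      fun _ => hM.sum_mem fun _ _ => hM.sq_mem _
    have hηθ : 4 * min (η / 4) 1 ≤ η := by linarith [min_le_left (η / 4) 1]
    refine ⟨Fin n × K, inferInstance, _, fun p => Function.update (y p.2) a (z p.1), fun p => ?_,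
      hprod.mono hM zero_le_one hηθ (by rwa [one_mul]) fun p => ?_⟩
    · exact ⟨le_update_iff.2 ⟨(hz p.1).1, fun i _ => (hy p.2).1 i⟩,
        update_le_iff.2 ⟨(hz p.1).2, fun i _ => (hy p.2).2 i⟩⟩
    · have hs : ∑ i ∈ s, (b i - algebraMap ℝ A (Function.update (y p.2) a (z p.1) i)) ^ 2 =
          ∑ i ∈ s, (b i - algebraMap ℝ A (y p.2 i)) ^ 2 :=
        Finset.sum_congr rfl fun i hi => by
          rw [Function.update_of_ne (ne_of_mem_of_not_mem hi ha)]
      simp only [Finset.sum_insert ha, hs, Function.update_self, one_smul, sub_self]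
      exact hM.zero_mem

section SqDist

variable {ι : Type*} [Fintype ι]

/-- The squared Euclidean distance between the tuple `b` of elements of `A` and the point `r`. -/
def sqDist (b : ι → A) (r : ι → ℝ) : A :=
  ∑ i, (b i - algebraMap ℝ A (r i)) ^ 2

theorem sqDist_mem (hM : IsQuadraticModule M) (b : ι → A) (r : ι → ℝ) : sqDist b r ∈ M :=
  hM.sum_mem fun _ _ => hM.sq_mem _

theorem two_smul_sqDist_add_sub_sqDist_mem (hM : IsQuadraticModule M) (b : ι → A) (r y : ι → ℝ) :
    (2 : ℝ) • sqDist b y + algebraMap ℝ A (2 * ∑ i, (y i - r i) ^ 2) - sqDist b r ∈ M := by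
  convert hM.sum_mem (s := Finset.univ) fun i _ =>
    hM.sq_mem (b i - algebraMap ℝ A (y i) - algebraMap ℝ A (y i - r i)) using 1
  rw [sqDist, sqDist, map_mul, map_sum, Finset.smul_sum, Finset.mul_sum, ← Finset.sum_add_distrib,
    ← Finset.sum_sub_distrib]
  refine Finset.sum_congr rfl fun i _ => ?_
  algebra

theorem AbsLE.sum_mul_sum_mul (hM : IsQuadraticModule M) {κ : Type*} [Fintype κ]
    {c : ι → κ → A} {C : ℝ} (hc : ∀ i j, AbsLE M (c i j) (algebraMap ℝ A C)) (z : ι → A)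
    (w : κ → A) {δ : ℝ} (hδ : 0 < δ) :
    AbsLE M (∑ i, z i * ∑ j, c i j * w j)
      ((C / 4) • ((∑ j, (w j ^ 2 + 1)) * ∑ i, (algebraMap ℝ A δ + δ⁻¹ • z i ^ 2))) := by
  convert AbsLE.sum hM (s := Finset.univ) fun i _ => AbsLE.sum hM (s := Finset.univ) fun j _ =>
    ((hc i j).mul_left_weighted hM (z i) hδ).mul_left hM (w j) using 1
  · simp only [Finset.mul_sum]
    exact Finset.sum_congr rfl fun i _ => Finset.sum_congr rfl fun j _ => by ring
  · rw [mul_comm, Finset.sum_mul_sum, Finset.smul_sum]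
    refine Finset.sum_congr rfl fun i _ => ?_
    rw [Finset.smul_sum]
    refine Finset.sum_congr rfl fun j _ => ?_
    generalize δ⁻¹ = d
    algebra

theorem exists_add_mul_sqDist_mem (hM : IsQuadraticModule M) {κ : Type*} [Fintype κ]
    {b : ι → A} {r : ι → ℝ} {c : ι → κ → A} (hc : ∀ i j, c i j ∈ hM.boundedSubalgebra)
    {w : κ → A} {m : A} (hm : m ∈ M) {ε : ℝ} (hε : 0 < ε) :
    ∃ D : ℝ, 0 ≤ D ∧ m + ∑ i, (b i - algebraMap ℝ A (r i)) * ∑ j, c i j * w j +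
      (∑ j, (w j ^ 2 + 1)) * (algebraMap ℝ A ε + D • sqDist b r) ∈ M := by
  obtain ⟨C, hC, hcC⟩ := hM.exists_forall_absLE (a := fun p : ι × κ => c p.1 p.2) fun p => hc _ _
  set N : ℝ := (Fintype.card ι : ℝ)
  have hN : 0 ≤ N := Nat.cast_nonneg _
  set δ : ℝ := ε / (C / 4 * N + 1)
  have hδ : 0 < δ := by positivity
  have hδε : C / 4 * N * δ ≤ ε := by
    rw [mul_div_assoc', div_le_iff₀ (by positivity)]
    nlinarith [mul_nonneg hC hN]
  have hbound := hM.add_mem _ hm _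
    (AbsLE.sum_mul_sum_mul hM (fun i j => hcC (i, j)) (fun i => b i - algebraMap ℝ A (r i)) w hδ).2
  refine ⟨C / 4 * δ⁻¹, by positivity, ?_⟩
  convert hM.add_mem _ hbound _
    (hM.isSumSq_mul_mem (isSumSq_sum_sq_add_one w)
      (hM.algebraMap_mem (sub_nonneg.2 hδε))) using 1
  have hsum : ∑ i, (algebraMap ℝ A δ + δ⁻¹ • (b i - algebraMap ℝ A (r i)) ^ 2) =
      algebraMap ℝ A (N * δ) + δ⁻¹ • sqDist b r := by
    simp [Finset.sum_add_distrib, ← Finset.smul_sum, sqDist, N]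
  rw [hsum]
  generalize δ⁻¹ = d
  algebra

theorem exists_forall_add_mul_sqDist_mem (hM : IsQuadraticModule M) {b : ι → A} {x q : A}
    (hq : IsSumSq q) {S : Set (ι → ℝ)} (hS : IsCompact S)
    (hx : ∀ r ∈ S, ∀ ε : ℝ, 0 < ε →
      ∃ D : ℝ, 0 ≤ D ∧ x + q * (algebraMap ℝ A ε + D • sqDist b r) ∈ M)
    {ε : ℝ} (hε : 0 < ε) :
    ∃ D : ℝ, 0 ≤ D ∧ ∀ y ∈ S, x + q * (algebraMap ℝ A ε + D • sqDist b y) ∈ M := by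
  have hmono {C D : ℝ} (hCD : C ≤ D) {y : ι → ℝ}
      (h : x + q * (algebraMap ℝ A ε + C • sqDist b y) ∈ M) :
      x + q * (algebraMap ℝ A ε + D • sqDist b y) ∈ M :=
    hM.add_isSumSq_mul_mono hq h
      (by simpa [← sub_smul] using hM.smul_mem (sub_nonneg.2 hCD) (sqDist_mem hM b y))
  refine hS.induction_on (p := fun s => ∃ D : ℝ, 0 ≤ D ∧ ∀ y ∈ s,
    x + q * (algebraMap ℝ A ε + D • sqDist b y) ∈ M) ⟨0, le_rfl, by simp⟩
    (fun s s' hs ⟨D, hD, h⟩ => ⟨D, hD, fun y hy => h y (hs hy)⟩) ?_ fun r hr => ?_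
  · rintro s s' ⟨C, hC, hs⟩ ⟨D, -, hs'⟩
    refine ⟨max C D, le_max_of_le_left hC, fun y hy => hy.elim (fun hy => ?_) fun hy => ?_⟩
    · exact hmono (le_max_left _ _) (hs y hy)
    · exact hmono (le_max_right _ _) (hs' y hy)
  · obtain ⟨D, hD, hDr⟩ := hx r hr (ε / 2) (half_pos hε)
    refine ⟨{y | D * (2 * ∑ i, (y i - r i) ^ 2) < ε / 2}, mem_nhdsWithin_of_mem_nhds
      ((isOpen_lt (by fun_prop) continuous_const).mem_nhds (by simpa using hε)),
      2 * D, by positivity, fun y hy => hM.add_isSumSq_mul_mono hq hDr ?_⟩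
    have hrest : 0 ≤ ε / 2 - D * (2 * ∑ i, (y i - r i) ^ 2) := sub_nonneg.2 (le_of_lt hy)
    convert hM.add_mem _ (hM.smul_mem hD (two_smul_sqDist_add_sub_sqDist_mem hM b r y)) _
      (hM.algebraMap_mem hrest) using 1
    algebra

end SqDist

theorem IsSqPartition.add_mem (hM : IsQuadraticModule M) {K : Type*} [Fintype K] {η : ℝ}
    {h d : K → A} (hd : IsSqPartition M η h d) {x q : A} (hq : IsSumSq q) {ε D : ℝ} (hε : 0 ≤ ε)
    (hD : 0 ≤ D) (hx : ∀ k, x + q * (algebraMap ℝ A ε + D • d k) ∈ M) :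
    x + q * algebraMap ℝ A (ε * (1 + η) + D * η) + (η / 2) • (x ^ 2 + 1) ∈ M := by
  have hglued : ∑ k, h k ^ 2 * (x + q * (algebraMap ℝ A ε + D • d k)) ∈ M :=
    hM.sum_mem fun k _ => hM.sq_mul_mem _ _ (hx k)
  have hsum : ∑ k, h k ^ 2 * (x + q * (algebraMap ℝ A ε + D • d k)) =
      (∑ k, h k ^ 2) * x +
        q * (algebraMap ℝ A ε * ∑ k, h k ^ 2 + D • ∑ k, h k ^ 2 * d k) := by
    simp only [Finset.sum_mul, Finset.mul_sum, Finset.smul_sum, ← Finset.sum_add_distrib]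
    refine Finset.sum_congr rfl fun k _ => ?_
    algebra
  have hbound : algebraMap ℝ A (ε * (1 + η) + D * η) -
      (algebraMap ℝ A ε * ∑ k, h k ^ 2 + D • ∑ k, h k ^ 2 * d k) ∈ M := by
    convert hM.add_mem _ (hM.smul_mem hε hd.absLE_sum_sub_one.1) _
      (hM.smul_mem hD hd.sub_sum_mem) using 1
    algebra
  rw [hsum] at hglued
  convert hM.add_mem _ (hM.add_isSumSq_mul_mono hq hglued hbound) _
    (hd.absLE_sum_sub_one.mul_left hM x).1 using 1
  algebra

theorem add_smul_mem_of_forall_mem_Icc (hM : IsQuadraticModule M) {ι : Type*} [Fintype ι]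
    {b : ι → A} {lo hi : ι → ℝ} (hle : lo ≤ hi) (hhi : ∀ i, algebraMap ℝ A (hi i) - b i ∈ M)
    (hlo : ∀ i, b i - algebraMap ℝ A (lo i) ∈ M) {x q : A} (hq : IsSumSq q)
    (hx : ∀ r ∈ Set.Icc lo hi, ∀ ε : ℝ, 0 < ε →
      ∃ D : ℝ, 0 ≤ D ∧ x + q * (algebraMap ℝ A ε + D • sqDist b r) ∈ M)
    {ε : ℝ} (hε : 0 < ε) : x + ε • (q + (x ^ 2 + 1)) ∈ M := by
  obtain ⟨D, hD, hDx⟩ :=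
    exists_forall_add_mul_sqDist_mem hM hq isCompact_Icc hx (ε := ε / 4) (by positivity)
  obtain ⟨η, hη, hη₁, hDη⟩ : ∃ η : ℝ, 0 < η ∧ η ≤ 1 ∧ (D + 1) * η ≤ ε / 2 := by
    refine ⟨min 1 (ε / 2 / (D + 1)), lt_min one_pos (by positivity), min_le_left _ _, ?_⟩
    rw [mul_comm, ← le_div_iff₀ (by positivity)]
    exact min_le_right _ _
  obtain ⟨K, _, h, y, hy, hh⟩ := exists_isSqPartition_pi hM hle hhi hlo Finset.univ hη
  have hglued := hh.add_mem hM hq (by positivity) hD fun k => hDx (y k) (hy k)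
  have hq_rest := hM.isSumSq_mul_mem hq
    (hM.algebraMap_mem (c := ε - (ε / 4 * (1 + η) + D * η)) (by nlinarith))
  have hx_rest := hM.smul_mem (c := ε - η / 2) (by nlinarith)
    (hM.add_mem _ (hM.sq_mem x) _ hM.one_mem)
  convert hM.add_mem _ (hM.add_mem _ hglued _ hq_rest) _ hx_rest using 1
  algebra

section Closure

variable {E : Type*} [AddCommGroup E] [Module ℝ E]

theorem mem_ddagger_of_forall_add_smul_mem {C : Set E} {x q : E}
    (h : ∀ ε : ℝ, 0 < ε → x + ε • q ∈ C) : x ∈ ddagger C := by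
  let _ := finestLocallyConvexTopology E
  obtain ⟨_, _, -⟩ := isLocallyConvexTopology_finest E
  refine ⟨fun n : ℕ => x + (1 / ((n : ℝ) + 1)) • q, fun n => h _ (by positivity), ?_⟩
  simpa using (tendsto_const_nhds (x := x)).add
    ((tendsto_one_div_add_atTop_nhds_zero_nat (𝕜 := ℝ)).smul_const q)

theorem continuous_linearMap_finest (L : E →ₗ[ℝ] ℝ) :
    @Continuous E ℝ (finestLocallyConvexTopology E) _ L :=
  continuous_iff_le_induced.2 (finestLocallyConvexTopology_le E
    ⟨topologicalAddGroup_induced L, continuousSMul_induced L, LocallyConvexSpace.induced L⟩)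

theorem ddagger_subset_lcClosure (C : Set E) : ddagger C ⊆ lcClosure C :=
  @seqClosure_subset_closure E (finestLocallyConvexTopology E) C

theorem lcClosure_subset_doubleDual (C : Set E) : lcClosure C ⊆ doubleDual C := by
  let _ := finestLocallyConvexTopology E
  intro x hx L hL
  exact closure_minimal (t := L ⁻¹' Set.Ici 0) (fun m hm => hL m hm)
    (isClosed_Ici.preimage (continuous_linearMap_finest L)) hx

theorem doubleDual_mono {C D : Set E} (h : C ⊆ D) : doubleDual C ⊆ doubleDual D :=
  fun _ hx L hL => hx L fun m hm => hL m (h hm)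

end Closure

theorem doubleDual_subset_Pos (M : Set A) : doubleDual M ⊆ Pos (positivitySet M) :=
  fun _ hx α hα => hx α.toLinearMap hα

theorem Pos_positivitySet_mono {N : Set A} (h : M ⊆ N) :
    Pos (positivitySet M) ⊆ Pos (positivitySet N) :=
  fun _ hx α hα => hx α fun m hm => hα m (h hm)

section SumsOfSquares

variable {V : Submodule ℝ A} {σ : A}

theorem isSumSq_of_mem_sumsOfSquares (hσ : σ ∈ sumsOfSquares V) : IsSumSq σ := by
  refine AddSubmonoid.closure_induction (motive := fun σ _ => IsSumSq σ) ?_ .zero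
    (fun _ _ _ _ => .add) hσ
  rintro _ ⟨v, -, rfl⟩
  exact pow_two v ▸ .mul_self v

theorem mem_mul_self_of_mem_sumsOfSquares (hσ : σ ∈ sumsOfSquares V) : σ ∈ V * V := by
  refine AddSubmonoid.closure_induction (motive := fun σ _ => σ ∈ V * V) ?_ (zero_mem _)
    (fun _ _ _ _ => add_mem) hσ
  rintro _ ⟨v, hv, rfl⟩
  exact pow_two v ▸ Submodule.mul_mem_mul hv hv

end SumsOfSquares

section Fibres

variable {t : ℕ} {b : Fin t → A} {lo hi : Fin t → ℝ}

theorem subset_fibreModule (M : Set A) (b : Fin t → A) (r : Fin t → ℝ) : M ⊆ fibreModule M b r :=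
  fun m hm => ⟨m, hm, 0, ⟨0, by simp, by simp⟩, add_zero m⟩

theorem iInter_add_fibreJ_subset_ddagger (hM : IsQuadraticModule M) (hle : lo ≤ hi)
    (hhi : ∀ i, algebraMap ℝ A (hi i) - b i ∈ M) (hlo : ∀ i, b i - algebraMap ℝ A (lo i) ∈ M)
    {B : Subalgebra ℝ A} (hB : B ≤ hM.boundedSubalgebra) {W : Submodule B A} (hW : W.FG) :
    ⋂ r ∈ Set.Icc lo hi, (M + fibreJ b r (W : Set A)) ⊆ ddagger M := by
  intro x hx
  obtain ⟨n, w, rfl⟩ := Submodule.fg_iff_exists_fin_generating_family.1 hW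
  refine mem_ddagger_of_forall_add_smul_mem fun ε hε => add_smul_mem_of_forall_mem_Icc hM hle hhi
    hlo (isSumSq_sum_sq_add_one w) (fun r hr δ hδ => ?_) hε
  obtain ⟨m, hm, _, ⟨v, hv, rfl⟩, rfl⟩ := Set.mem_iInter₂.1 hx r hr
  choose c hc using fun i => (Submodule.mem_span_range_iff_exists_fun B).1 (hv i)
  obtain rfl : (fun i => ∑ j, (c i j : A) * w j) = v := funext hc
  exact exists_add_mul_sqDist_mem hM (fun i j => hB (c i j).2) hm hδ

theorem boundedQM_fibreGenerators_subset (hM : IsQuadraticModule M) {s : ℕ} {f : Fin s → A}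
    (hf : ∀ i, f i ∈ M) (r : Fin t → ℝ) (V : Submodule ℝ A) :
    boundedQM (fibreGenerators f b r) V ⊆ M + fibreJ b r ((V * V : Submodule ℝ A) : Set A) := by
  rintro _ ⟨σ₀, hσ₀, σ, hσ, rfl⟩
  refine ⟨σ₀ + ∑ i, σ (.inl i) * f i, ?_, _,
    ⟨fun i => σ (.inr (.inl i)) - σ (.inr (.inr i)), fun i => sub_mem
      (mem_mul_self_of_mem_sumsOfSquares (hσ _)) (mem_mul_self_of_mem_sumsOfSquares (hσ _)), rfl⟩,
    ?_⟩
  · refine hM.add_mem _ ?_ _ (hM.sum_mem fun i _ =>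
      hM.isSumSq_mul_mem (isSumSq_of_mem_sumsOfSquares (hσ _)) (hf i))
    simpa using hM.isSumSq_mul_mem (isSumSq_of_mem_sumsOfSquares hσ₀) hM.one_mem
  · simp only [fibreGenerators, Fintype.sum_sum_type, Sum.elim_inl, Sum.elim_inr, add_assoc,
      ← Finset.sum_add_distrib]
    congr! 3
    ring

theorem iInter_fibreModule_subset_ddagger (hM : IsQuadraticModule M) (hle : lo ≤ hi)
    (hhi : ∀ i, algebraMap ℝ A (hi i) - b i ∈ M) (hlo : ∀ i, b i - algebraMap ℝ A (lo i) ∈ M)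
    {s : ℕ} {f : Fin s → A} (hf : ∀ i, f i ∈ M) {Φ : Submodule ℝ A → Submodule ℝ A}
    (hΦ : ∀ r ∈ Set.Icc lo hi, IsStabilityMap (fibreModule M b r) (fibreGenerators f b r) Φ) :
    ⋂ r ∈ Set.Icc lo hi, fibreModule M b r ⊆ ddagger M := by
  intro x hx
  set U : Submodule ℝ A := Submodule.span ℝ {x}
  have hV : (Φ U).FG := Module.Finite.iff_fg.1 (hΦ lo ⟨le_rfl, hle⟩ U inferInstance).1
  obtain ⟨S, hS⟩ := hV.mul hV
  have hVB : Φ U * Φ U ≤ (Submodule.span (⊥ : Subalgebra ℝ A) (S : Set A)).restrictScalars ℝ := by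
    rw [← hS]
    exact Submodule.span_le_restrictScalars ℝ _ _
  refine iInter_add_fibreJ_subset_ddagger hM hle hhi hlo bot_le ⟨S, rfl⟩
    (Set.mem_iInter₂.2 fun r hr => ?_)
  obtain ⟨m, hm, _, ⟨w, hw, rfl⟩, hmx⟩ := boundedQM_fibreGenerators_subset hM hf r (Φ U)
    ((hΦ r hr U inferInstance).2
      ⟨Set.mem_iInter₂.1 hx r hr, Submodule.mem_span_singleton_self x⟩)
  exact ⟨m, hm, _, ⟨w, fun i => hVB (hw i), rfl⟩, hmx⟩

end Fibres

end FibreTheorem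

open FibreTheorem in
theorem mainTheorem1_general {A : Type*} [CommRing A] [Algebra ℝ A] {M : Set A}
    (hM : IsQuadraticModule M) {t : ℕ} {b : Fin t → A} {lo hi : Fin t → ℝ} (hle : lo ≤ hi)
    (hhi : ∀ i, algebraMap ℝ A (hi i) - b i ∈ M) (hlo : ∀ i, b i - algebraMap ℝ A (lo i) ∈ M) :
    (∀ B ≤ hM.boundedSubalgebra, ∀ W : Submodule B A, W.FG →
      ⋂ r ∈ Set.Icc lo hi, (M + fibreJ b r (W : Set A)) ⊆ ddagger M) ∧
    (∀ (s : ℕ) (f : Fin s → A), (∀ i, f i ∈ M) → ∀ Φ : Submodule ℝ A → Submodule ℝ A,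
      (∀ r ∈ Set.Icc lo hi, IsStabilityMap (fibreModule M b r) (fibreGenerators f b r) Φ) →
      ((∀ r ∈ Set.Icc lo hi, IsClosedCone (fibreModule M b r)) → ddagger M = lcClosure M) ∧
      ((∀ r ∈ Set.Icc lo hi, IsSaturated (fibreModule M b r)) → HasDDaggerProperty M)) := by
  refine ⟨fun B hB W hW => iInter_add_fibreJ_subset_ddagger hM hle hhi hlo hB hW,
    fun s f hf Φ hΦ => ?_⟩
  have hfibre := iInter_fibreModule_subset_ddagger hM hle hhi hlo hf hΦ
  have hdual : lcClosure M ⊆ doubleDual M := lcClosure_subset_doubleDual M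
  refine ⟨fun hclosed => (ddagger_subset_lcClosure M).antisymm (.trans ?_ hfibre),
    fun hsat => Set.Subset.antisymm ?_ (.trans ?_ hfibre)⟩
  · refine Set.subset_iInter₂ fun r hr => ?_
    rw [hclosed r hr]
    exact hdual.trans (doubleDual_mono (subset_fibreModule M b r))
  · exact (ddagger_subset_lcClosure M).trans (hdual.trans (doubleDual_subset_Pos M))
  · refine Set.subset_iInter₂ fun r hr => ?_
    rw [hsat r hr]
    exact Pos_positivitySet_mono (subset_fibreModule M b r)

theorem mainTheorem1 {A : Type*} [CommRing A] [Algebra ℝ A] (M : Set A)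
    (hM : FibreTheorem.IsQuadraticModule M) {t : ℕ} (b : Fin t → A) (lo hi : Fin t → ℝ)
    (hle : ∀ i, lo i ≤ hi i)
    (hhi : ∀ i, algebraMap ℝ A (hi i) - b i ∈ M)
    (hlo : ∀ i, b i - algebraMap ℝ A (lo i) ∈ M) :
    (∀ W : Submodule (Algebra.adjoin ℝ (Set.range b)) A, W.FG →
      (⋂ r ∈ Set.univ.pi (fun i => Set.Icc (lo i) (hi i)),
        (M + FibreTheorem.fibreJ b r (W : Set A))) ⊆ FibreTheorem.ddagger M) ∧
    (∀ (s : ℕ) (f : Fin s → A), M = FibreTheorem.QM (Set.range f) →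
      ∀ Φ : Submodule ℝ A → Submodule ℝ A,
      (∀ r ∈ Set.univ.pi (fun i => Set.Icc (lo i) (hi i)),
        FibreTheorem.IsStabilityMap (FibreTheorem.fibreModule M b r)
          (FibreTheorem.fibreGenerators f b r) Φ) →
      ((∀ r ∈ Set.univ.pi (fun i => Set.Icc (lo i) (hi i)),
          FibreTheorem.IsClosedCone (FibreTheorem.fibreModule M b r)) →
        FibreTheorem.ddagger M = FibreTheorem.lcClosure M) ∧
      ((∀ r ∈ Set.univ.pi (fun i => Set.Icc (lo i) (hi i)),
          FibreTheorem.IsSaturated (FibreTheorem.fibreModule M b r)) →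
        FibreTheorem.HasDDaggerProperty M)) := by
  obtain ⟨hJ, hstable⟩ := mainTheorem1_general hM hle hhi hlo
  rw [Set.pi_univ_Icc]
  exact ⟨hJ _ (hM.adjoin_range_le_boundedSubalgebra hhi hlo),
    fun s f hMf => hstable s f fun i => hMf ▸ FibreTheorem.subset_QM _ ⟨i, rfl⟩⟩
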